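/- Graphs are finite and undirected; loops and parallel edges are allowed. For a graph $G$ put $\Delta(G)=|E(G)|-|V(G)|$. Let $S(x,G)$ be the set of edges (including loops) incident to the vertex $x$, let $\mathcal{S}(G)=\{S(x,G): x\in V(G)\}$, and let $G\setminus x$ be the graph obtained from $G$ by deleting $x$ together with all edges incident to it. A graph is a cacti-graph if it has no isolated vertices, no leaves (vertices of degree $1$, where a loop contributes $2$ to the degree) and no connected component that is a cycle (a loop and a pair of parallel edges being cycles of length $1$ and $2$); a cactus is a connected cacti-graph. For $C\subseteq E(G)$ let $G\langle C\rangle$ be the subgraph formed by the edges of $C$ and their ends. The bicircular matroid $M_1(G)$ is the matroid on $E(G)$ whose circuits are the sets $C\subseteq E(G)$ such that $\Delta(G\langle C\rangle)=1$ and $G\langle C\rangle$ is a cacti-graph. Graphs $G$ and $G'$ are strongly isomorphic if $E(G)=E(G')$ and there is a bijection $\nu:V(G)\to V(G')$ such that, for every edge $e$ and all $x,y\in V(G)$, $e$ has ends $x,y$ in $G$ if and only if $e$ has ends $\nu(x),\nu(y)$ in $G'$. **Theorem.** Let $G$ and $G'$ be finite graphs, where $G'$ has no isolated vertices. Suppose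 that (a1) $\Delta(G)\ge 1$ and $G$ is a cactus, (a2) for every vertex $x$ of $G$, $\Delta(G\setminus x)\ge 1$ and $G\setminus x$ is a cactus, and (a3) $M_1(G')=M_1(G)$. Then $\mathcal{S}(G)=\mathcal{S}(G')$, and $G$ and $G'$ are strongly isomorphic. -/

import Mathlib

open scoped Graph

namespace KCircular

/-! Graphs are Mathlib's multigraphs `Graph α β` (vertices in `α`, edges in `β`, loops and parallel
edges allowed), with vertex set `V(G)` and edge set `E(G)`. -/

/-- `G` is a finite graph. -/
def IsFiniteGraph {α β : Type*} (G : Graph α β) : Prop :=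
  V(G).Finite ∧ E(G).Finite

/-- `Δ(G) = |E(G)| - |V(G)|`, an integer (used for finite graphs only). -/
noncomputable def excess {α β : Type*} (G : Graph α β) : ℤ :=
  (E(G).ncard : ℤ) - (V(G).ncard : ℤ)

/-- The vertex star `S(x, G)`: the set of all edges (loops included) incident to `x`. -/
def star {α β : Type*} (G : Graph α β) (x : α) : Set β :=
  G.incidenceSet x

/-- The set `𝒮(G)` of all vertex stars of `G`. -/
def vertexStars {α β : Type*} (G : Graph α β) : Set (Set β) :=
  {S | ∃ x ∈ V(G), S = star G x}

/-- The degree of a vertex; a loop is counted twice. -/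
noncomputable def degree {α β : Type*} (G : Graph α β) (x : α) : ℕ :=
  (G.incidenceSet x).ncard + (G.loopSet x).ncard

/-- `G` has no isolated vertices. -/
def NoIsolatedVertices {α β : Type*} (G : Graph α β) : Prop :=
  ∀ x ∈ V(G), ∃ e, G.Inc e x

/-- `G` has no leaves, that is, no vertices of degree one. -/
def NoLeaves {α β : Type*} (G : Graph α β) : Prop :=
  ∀ x ∈ V(G), degree G x ≠ 1

/-- A graph is connected if it has a vertex and any two vertices are joined by a walk. -/
def IsConnected {α β : Type*} (G : Graph α β) : Prop :=
  V(G).Nonempty ∧ ∀ x ∈ V(G), ∀ y ∈ V(G), Relation.ReflTransGen G.Adj x y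

/-- `H` is a (connected) component of `G`. Here `H ≤c G` means that `H` is a subgraph of `G` which
contains every edge of `G` having an end in `H`. -/
def IsComponent {α β : Type*} (H G : Graph α β) : Prop :=
  H.IsClosedSubgraph G ∧ IsConnected H

/-- A cycle is a finite connected graph in which all degrees are two (a vertex with a loop and a
pair of parallel edges are cycles of length one and two). -/
def IsCycleGraph {α β : Type*} (H : Graph α β) : Prop :=
  IsFiniteGraph H ∧ IsConnected H ∧ ∀ x ∈ V(H), degree H x = 2

/-- Cacti-graphs: no isolated vertices, no leaves and no components that are cycles. -/
def IsCactiGraph {α β : Type*} (G : Graph α β) : Prop :=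
  NoIsolatedVertices G ∧ NoLeaves G ∧ ∀ H : Graph α β, IsComponent H G → ¬ IsCycleGraph H

/-- A cactus is a connected cacti-graph. -/
def IsCactus {α β : Type*} (G : Graph α β) : Prop :=
  IsConnected G ∧ IsCactiGraph G

/-- The subgraph `G⟨X⟩` of `G` induced by a set `X` of edges: its edges are those of `X` and its
vertices are the ends of these edges. -/
def edgeInduced {α β : Type*} (G : Graph α β) (X : Set β) : Graph α β where
  vertexSet := {x | ∃ e ∈ X, G.Inc e x}
  edgeSet := E(G) ∩ X
  IsLink e x y := e ∈ X ∧ G.IsLink e x y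
  isLink_symm _ _ := { symm _ _ h := ⟨h.1, h.2.symm⟩ }
  eq_or_eq_of_isLink_of_isLink _ _ _ _ _ h h' := h.2.left_eq_or_eq h'.2
  edge_mem_iff_exists_isLink e :=
    ⟨fun h ↦ by
      obtain ⟨x, y, hxy⟩ := G.exists_isLink_of_mem_edgeSet h.1
      exact ⟨x, y, h.2, hxy⟩, fun ⟨_, _, h⟩ ↦ ⟨h.2.edge_mem, h.1⟩⟩
  left_mem_of_isLink e _ _ h := ⟨e, h.1, h.2.inc_left⟩

/-- The family `𝒞_k(G)` of all (finite) edge sets `C` of `G` such that `Δ(G⟨C⟩) = k` and `G⟨C⟩` is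
a cacti-graph. -/
def circuits {α β : Type*} (G : Graph α β) (k : ℕ) : Set (Set β) :=
  {C | C ⊆ E(G) ∧ C.Finite ∧ excess (edgeInduced G C) = k ∧ IsCactiGraph (edgeInduced G C)}

/-- Two graphs are strongly isomorphic if they have the same edge set and there is a bijection `ν`
of their vertex sets such that `e` has ends `x, y` in the first graph if and only if it has ends
`ν x, ν y` in the second. -/
def StronglyIsomorphic {α α' β : Type*} (G : Graph α β) (G' : Graph α' β) : Prop :=
  E(G) = E(G') ∧ ∃ ν : V(G) ≃ V(G'), ∀ (e : β) (x y : V(G)),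
    G.IsLink e x y ↔ G'.IsLink e (ν x) (ν y)

/-! ### The family `circuits G k` is the family of circuits of a matroid -/

theorem edgeInduced_inc {α β : Type*} {G : Graph α β} {X : Set β} {e : β} {x : α} :
    (edgeInduced G X).Inc e x ↔ e ∈ X ∧ G.Inc e x := by
  simp [Graph.Inc, edgeInduced]

theorem edgeInduced_isLoopAt {α β : Type*} {G : Graph α β} {X : Set β} {e : β} {x : α} :
    (edgeInduced G X).IsLoopAt e x ↔ e ∈ X ∧ G.IsLoopAt e x := Iff.rfl

theorem finite_ends {α β : Type*} (G : Graph α β) (e : β) : {x | G.Inc e x}.Finite := by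
  by_cases h : e ∈ E(G)
  · obtain ⟨a, b, hab⟩ := G.exists_isLink_of_mem_edgeSet h
    refine (Set.toFinite {a, b}).subset fun x hx ↦ ?_
    simpa using hx.eq_or_eq_of_isLink hab
  · simp [h]

theorem finite_vertexSet {α β : Type*} (G : Graph α β) (X : Finset β) :
    V(edgeInduced G (X : Set β)).Finite := by
  have : V(edgeInduced G (X : Set β)) = ⋃ e ∈ (X : Set β), {x | G.Inc e x} := by
    ext x; simp [edgeInduced]
  rw [this]
  exact X.finite_toSet.biUnion fun e _ ↦ finite_ends G e

/-- The set of vertices of `G⟨X⟩`, as a finset. -/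
noncomputable def ends {α β : Type*} (G : Graph α β) (X : Finset β) : Finset α :=
  (finite_vertexSet G X).toFinset

theorem mem_ends {α β : Type*} {G : Graph α β} {X : Finset β} {x : α} :
    x ∈ ends G X ↔ ∃ e ∈ X, G.Inc e x := by
  simp [ends, edgeInduced]

theorem excess_edgeInduced {α β : Type*} {G : Graph α β} {X : Finset β} (h : (X : Set β) ⊆ E(G)) :
    excess (edgeInduced G (X : Set β)) = (X.card : ℤ) - (ends G X).card := by
  have h1 : E(edgeInduced G (X : Set β)) = (X : Set β) := Set.inter_eq_right.2 h
  have h2 : V(edgeInduced G (X : Set β)) = (ends G X : Set α) := by simp [ends]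
  rw [excess, h1, h2, Set.ncard_coe_finset, Set.ncard_coe_finset]

open Classical in
/-- The number of ends of the edge `e` in `W`; a loop has two equal ends. -/
noncomputable def endCount {α β : Type*} (G : Graph α β) (W : Finset α) (e : β) : ℕ :=
  {w ∈ W | G.Inc e w}.card + {w ∈ W | G.IsLoopAt e w}.card

open Classical in
theorem endCount_le {α β : Type*} (G : Graph α β) (W : Finset α) (e : β) :
    endCount G W e ≤ 2 ∧ (endCount G W e = 2 → ∀ x, G.Inc e x → x ∈ W) ∧
      (e ∈ E(G) → (∀ x, G.Inc e x → x ∈ W) → endCount G W e = 2) := by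
  by_cases he : e ∈ E(G)
  swap
  · have h1 : ∀ x, ¬ G.Inc e x := fun x hx ↦ he hx.edge_mem
    have h2 : ∀ x, ¬ G.IsLoopAt e x := fun x hx ↦ he hx.edge_mem
    simp [endCount, h2, he]
  obtain ⟨a, b, hab⟩ := G.exists_isLink_of_mem_edgeSet he
  have hinc : ∀ x, G.Inc e x ↔ x = a ∨ x = b := fun x ↦
    ⟨fun h ↦ h.eq_or_eq_of_isLink hab, by
      rintro (rfl | rfl)
      exacts [hab.inc_left, hab.inc_right]⟩
  have hloop : ∀ x, G.IsLoopAt e x ↔ a = x ∧ b = x := fun x ↦ by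
    rw [← Graph.isLink_self_iff, hab.isLink_iff]
    tauto
  have hflt : ∀ c, {w ∈ W | w = c} = if c ∈ W then {c} else ∅ := fun c ↦ by
    split_ifs with hc <;> ext w <;> simp <;> grind
  by_cases h : a = b
  · subst h
    have e1 : {w ∈ W | G.Inc e w} = {w ∈ W | w = a} := by ext; simp [hinc]
    have e2 : {w ∈ W | G.IsLoopAt e w} = {w ∈ W | w = a} := by ext; simp [hloop, eq_comm]
    have hc : endCount G W e = if a ∈ W then 2 else 0 := by
      rw [endCount, e1, e2, hflt]
      by_cases ha : a ∈ W <;> simp [ha]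
    rw [hc]
    by_cases ha : a ∈ W <;> simp [ha, hinc]
  · have e1 : {w ∈ W | G.Inc e w} = {w ∈ W | w = a} ∪ {w ∈ W | w = b} := by
      ext; simp [hinc]; tauto
    have e2 : {w ∈ W | G.IsLoopAt e w} = ∅ := by
      ext w; simp only [hloop, Finset.mem_filter, Finset.notMem_empty, iff_false]
      rintro ⟨_, rfl, rfl⟩; exact h rfl
    have hc : endCount G W e = (if a ∈ W then 1 else 0) + (if b ∈ W then 1 else 0) := by
      rw [endCount, e1, e2, hflt, hflt]
      by_cases ha : a ∈ W <;> by_cases hb : b ∈ W <;> simp [ha, hb, h]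
    rw [hc]
    by_cases ha : a ∈ W <;> by_cases hb : b ∈ W <;> simp [ha, hb, hinc]

open Classical in
/-- Double counting of the pairs (vertex of `W`, incident edge). -/
theorem sum_degree {α β : Type*} (G : Graph α β) (W : Finset α) (Y : Finset β)
    (h : ∀ w ∈ W, ∀ e, G.Inc e w → e ∈ Y) :
    ∑ w ∈ W, degree G w = ∑ e ∈ Y, endCount G W e := by
  have hd : ∀ w ∈ W, degree G w =
      {e ∈ Y | G.Inc e w}.card + {e ∈ Y | G.IsLoopAt e w}.card := by
    intro w hw
    have h1 : G.incidenceSet w = ({e ∈ Y | G.Inc e w} : Finset β) := by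
      ext e; simpa using h w hw e
    have h2 : G.loopSet w = ({e ∈ Y | G.IsLoopAt e w} : Finset β) := by
      ext e; simpa using fun he : G.IsLoopAt e w ↦ h w hw e he.inc
    rw [degree, h1, h2, Set.ncard_coe_finset, Set.ncard_coe_finset]
  rw [Finset.sum_congr rfl hd, Finset.sum_add_distrib]
  simp only [endCount, Finset.sum_add_distrib]
  congr 1
  · exact Finset.sum_card_bipartiteAbove_eq_sum_card_bipartiteBelow (fun w e ↦ G.Inc e w)
  · exact Finset.sum_card_bipartiteAbove_eq_sum_card_bipartiteBelow (fun w e ↦ G.IsLoopAt e w)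

theorem IsCycleGraph.card_eq {α β : Type*} {H : Graph α β} (h : IsCycleGraph H) :
    E(H).ncard = V(H).ncard := by
  obtain ⟨⟨hV, hE⟩, -, hdeg⟩ := h
  have key := sum_degree H hV.toFinset hE.toFinset fun w _ e he ↦ by simpa using he.edge_mem
  rw [Finset.sum_congr rfl (g := fun _ ↦ 2) (fun w hw ↦ hdeg w (by simpa using hw)),
    Finset.sum_congr rfl (g := fun _ ↦ 2) (fun e he ↦ (endCount_le H _ e).2.2 (by simpa using he)
      fun x hx ↦ by simpa using hx.vertex_mem)] at key
  rw [Set.ncard_eq_toFinset_card _ hE, Set.ncard_eq_toFinset_card _ hV]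
  simp only [Finset.sum_const, smul_eq_mul] at key
  omega

theorem ends_mono {α β : Type*} (G : Graph α β) {X Y : Finset β} (h : X ⊆ Y) :
    ends G X ⊆ ends G Y := fun x hx ↦ by
  obtain ⟨e, he, hx⟩ := mem_ends.1 hx
  exact mem_ends.2 ⟨e, h he, hx⟩

theorem ends_pos {α β : Type*} {G : Graph α β} {X : Finset β} (hX : X.Nonempty)
    (h : (X : Set β) ⊆ E(G)) : 0 < (ends G X).card := by
  obtain ⟨e, he⟩ := hX
  obtain ⟨x, y, hxy⟩ := G.exists_isLink_of_mem_edgeSet (h he)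
  exact Finset.card_pos.2 ⟨x, mem_ends.2 ⟨e, he, hxy.inc_left⟩⟩

open Classical in
/-- A nonempty edge set `X` with `Δ(G⟨X⟩) ≥ k` contains a member of `circuits G k`. -/
theorem exists_circuit {α β : Type*} {G : Graph α β} {k : ℕ} (hk : 1 ≤ k) (X : Finset β)
    (hX : (X : Set β) ⊆ E(G)) (hne : X.Nonempty) (hc : (ends G X).card + k ≤ X.card) :
    ∃ C ∈ circuits G k, C ⊆ (X : Set β) := by
  induction X using Finset.strongInduction with
  | H X ih =>
    by_cases hmin : ∃ Y ⊂ X, Y.Nonempty ∧ (ends G Y).card + k ≤ Y.card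
    · obtain ⟨Y, hYX, hY, hYc⟩ := hmin
      have hsub : (Y : Set β) ⊆ X := by exact_mod_cast hYX.subset
      obtain ⟨C, hC, hCY⟩ := ih Y hYX (hsub.trans hX) hY hYc
      exact ⟨C, hC, hCY.trans hsub⟩
    push Not at hmin
    have hpos := ends_pos hne hX
    have hErase : ∀ e ∈ X, (X.erase e).Nonempty := fun e he ↦ by
      rw [← Finset.card_pos, Finset.card_erase_of_mem he]; omega
    refine ⟨X, ⟨hX, X.finite_toSet, ?_, ?_, ?_, ?_⟩, subset_rfl⟩
    · rw [excess_edgeInduced hX]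
      obtain ⟨e, he⟩ := id hne
      have h1 := hmin _ (Finset.erase_ssubset he) (hErase e he)
      have h2 := Finset.card_le_card (ends_mono G (Finset.erase_subset e X))
      rw [Finset.card_erase_of_mem he] at h1
      omega
    · rintro x ⟨e, he, hx⟩
      exact ⟨e, edgeInduced_inc.2 ⟨he, hx⟩⟩
    · rintro x ⟨e, he, hx⟩ hdeg
      have hfin : ((edgeInduced G (X : Set β)).incidenceSet x).Finite :=
        X.finite_toSet.subset fun f hf ↦ (edgeInduced_inc.1 hf).1
      have hpos' : 0 < ((edgeInduced G (X : Set β)).incidenceSet x).ncard :=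
        (Set.ncard_pos hfin).2 ⟨e, edgeInduced_inc.2 ⟨he, hx⟩⟩
      rw [degree] at hdeg
      obtain ⟨f, hf⟩ := Set.ncard_eq_one.1
        (show ((edgeInduced G (X : Set β)).incidenceSet x).ncard = 1 by omega)
      have huniq : ∀ g ∈ X, G.Inc g x → g = f := fun g hg hgx ↦ by
        have : g ∈ (edgeInduced G (X : Set β)).incidenceSet x := edgeInduced_inc.2 ⟨hg, hgx⟩
        simpa [hf] using this
      obtain rfl := huniq e he hx
      have h1 := hmin _ (Finset.erase_ssubset he) (hErase e he)
      have h2 : ends G (X.erase e) ⊂ ends G X := by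
        refine Finset.ssubset_iff_subset_ne.2 ⟨ends_mono G (Finset.erase_subset e X), fun heq ↦ ?_⟩
        have : x ∈ ends G (X.erase e) := heq ▸ mem_ends.2 ⟨e, he, hx⟩
        obtain ⟨g, hg, hgx⟩ := mem_ends.1 this
        rw [Finset.mem_erase] at hg
        exact hg.1 (huniq g hg.2 hgx)
      have h3 := Finset.card_lt_card h2
      rw [Finset.card_erase_of_mem he] at h1
      omega
    · rintro H ⟨hH, ⟨x₀, hx₀⟩, -⟩ hcyc
      have hcard := hcyc.card_eq
      obtain ⟨⟨hVf, hEf⟩, -, -⟩ := hcyc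
      have hEX : ∀ e ∈ E(H), e ∈ X := fun e he ↦ (hH.le.edgeSet_mono he).2
      have hVX : ∀ x ∈ V(H), x ∈ ends G X := fun x hx ↦
        mem_ends.2 (hH.le.vertexSet_mono hx)
      have hsubE : hEf.toFinset ⊆ X := fun e he ↦ hEX e (by simpa using he)
      have hsubV : hVf.toFinset ⊆ ends G X := fun e he ↦ hVX e (by simpa using he)
      rw [Set.ncard_eq_toFinset_card _ hEf, Set.ncard_eq_toFinset_card _ hVf] at hcard
      have hVpos : 0 < hVf.toFinset.card := Finset.card_pos.2 ⟨x₀, by simpa using hx₀⟩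
      have c1 := Finset.card_sdiff_of_subset hsubE
      have c2 := Finset.card_sdiff_of_subset hsubV
      have c3 := Finset.card_le_card hsubV
      have c4 := Finset.card_le_card hsubE
      have hsub : ends G (X \ hEf.toFinset) ⊆ ends G X \ hVf.toFinset := by
        intro x hx
        obtain ⟨e, he, hex⟩ := mem_ends.1 hx
        simp only [Finset.mem_sdiff, Set.Finite.mem_toFinset] at he ⊢
        exact ⟨mem_ends.2 ⟨e, he.1, hex⟩,
          fun hxH ↦ he.2 (hH.closed (edgeInduced_inc.2 ⟨he.1, hex⟩) hxH)⟩
      have c5 := Finset.card_le_card hsub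
      have h1 := hmin (X \ hEf.toFinset)
        (Finset.ssubset_iff_subset_ne.2 ⟨Finset.sdiff_subset, fun heq ↦ by
          rw [heq] at c1; omega⟩)
        (by rw [← Finset.card_pos]; omega)
      omega

/-- `Δ` strictly decreases when edges are removed from a cacti-graph. -/
theorem IsCactiGraph.excess_lt {α β : Type*} {G : Graph α β} {C X : Finset β}
    (hcac : IsCactiGraph (edgeInduced G (C : Set β))) (hX : X ⊂ C) :
    X.card + (ends G C).card < C.card + (ends G X).card := by
  classical
  set K := edgeInduced G (C : Set β) with hK
  obtain ⟨hiso, hleaf, hcyc⟩ := hcac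
  set W := ends G C \ ends G X with hW
  have cW : W.card = (ends G C).card - (ends G X).card :=
    Finset.card_sdiff_of_subset (ends_mono G hX.subset)
  have cY : (C \ X).card = C.card - X.card := Finset.card_sdiff_of_subset hX.subset
  have c1 := Finset.card_le_card (ends_mono G hX.subset)
  have c2 := Finset.card_lt_card hX
  by_contra! hcon
  have hinc : ∀ w ∈ W, ∀ e, K.Inc e w → e ∈ C \ X := by
    intro w hw e he
    rw [hK, edgeInduced_inc] at he
    rw [hW, Finset.mem_sdiff, mem_ends, mem_ends] at hw
    exact Finset.mem_sdiff.2 ⟨he.1, fun heX ↦ hw.2 ⟨e, heX, he.2⟩⟩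
  have hWV : ∀ w ∈ W, w ∈ V(K) := fun w hw ↦ by
    rw [hW, Finset.mem_sdiff, mem_ends] at hw
    exact hw.1
  have hfinE : ∀ x, (K.incidenceSet x).Finite := fun x ↦
    C.finite_toSet.subset fun e he ↦ (edgeInduced_inc.1 he).1
  have hdeg : ∀ w ∈ W, 2 ≤ degree K w := by
    intro w hw
    have h1 := hleaf w (hWV w hw)
    have h2 : 0 < (K.incidenceSet w).ncard := (Set.ncard_pos (hfinE w)).2 (hiso w (hWV w hw))
    simp only [degree] at h1 ⊢
    omega
  have hsum := sum_degree K W (C \ X) hinc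
  have s1 : ∑ _w ∈ W, 2 ≤ ∑ w ∈ W, degree K w := Finset.sum_le_sum hdeg
  have s2 : ∑ e ∈ C \ X, endCount K W e ≤ ∑ _e ∈ C \ X, 2 :=
    Finset.sum_le_sum fun e _ ↦ (endCount_le K W e).1
  have s3 : ∑ _w ∈ W, 2 = W.card * 2 := by simp
  have s4 : ∑ _e ∈ C \ X, 2 = (C \ X).card * 2 := by simp
  have hd2 : ∀ w ∈ W, 2 = degree K w := (Finset.sum_eq_sum_iff_of_le hdeg).1 (by omega)
  have he2 : ∀ e ∈ C \ X, endCount K W e = 2 :=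
    (Finset.sum_eq_sum_iff_of_le fun e _ ↦ (endCount_le K W e).1).1 (by omega)
  have hWne : W.Nonempty := by rw [← Finset.card_pos]; omega
  obtain ⟨w, hw⟩ := hWne
  have hadj : ∀ x ∈ W, ∀ y, K.Adj x y → y ∈ W := by
    rintro x hx y ⟨e, he⟩
    exact (endCount_le K W e).2.1 (he2 e (hinc x hx e he.inc_left)) y he.inc_right
  set D : Set α := {y | Relation.ReflTransGen K.Adj w y} with hD
  have hDW : ∀ y ∈ D, y ∈ W := by
    intro y hy
    induction hy with
    | refl => exact hw
    | tail _ h ih => exact hadj _ ih _ h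
  have hDlink : ∀ {e x y}, K.IsLink e x y → x ∈ D → y ∈ D := fun {e x y} h hx ↦
    Relation.ReflTransGen.tail (b := x) hx ⟨e, h⟩
  set H := K.induce D with hH
  have hlink : ∀ {e x y}, H.IsLink e x y ↔ K.IsLink e x y ∧ x ∈ D ∧ y ∈ D := Iff.rfl
  have hHD : V(H) = D := rfl
  have hHle : H ≤ K := Graph.induce_le fun y hy ↦ hWV y (hDW y hy)
  have hHadj : ∀ x ∈ D, Relation.ReflTransGen H.Adj w x := by
    intro x hx
    have hx' : Relation.ReflTransGen K.Adj w x := hx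
    induction hx' with
    | refl => exact Relation.ReflTransGen.refl
    | @tail b c hb hbc ih =>
      obtain ⟨e, he⟩ := hbc
      exact (ih hb).tail ⟨e, hlink.2 ⟨he, hb, hx⟩⟩
  have hsymm : Std.Symm (Relation.ReflTransGen H.Adj) := Relation.ReflTransGen.stdSymm
  have hconn : IsConnected H := by
    refine ⟨⟨w, Relation.ReflTransGen.refl⟩, fun x hx y hy ↦ ?_⟩
    refine Relation.ReflTransGen.trans ?_ (hHadj y hy)
    exact Std.Symm.symm _ _ (hHadj x hx)
  have hclosed : H.IsClosedSubgraph K :=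
    { vertexSet_mono := hHle.vertexSet_mono
      isLink_mono := hHle.isLink_mono
      isLink_of_mem_mem := fun e x y h hx hy ↦ hlink.2 ⟨h, hx, hy⟩
      closed := fun e x ⟨y, h⟩ hx ↦ (hlink.2 ⟨h, hx, hDlink h hx⟩).edge_mem }
  refine hcyc H ⟨hclosed, hconn⟩ ⟨⟨?_, ?_⟩, hconn, fun x hx ↦ ?_⟩
  · exact W.finite_toSet.subset hDW
  · exact C.finite_toSet.subset fun e he ↦ (hHle.edgeSet_mono he).2
  · have i1 : H.incidenceSet x = K.incidenceSet x := by
      ext e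
      exact ⟨fun ⟨y, h⟩ ↦ ⟨y, (hlink.1 h).1⟩, fun ⟨y, h⟩ ↦ ⟨y, hlink.2 ⟨h, hx, hDlink h hx⟩⟩⟩
    have i2 : H.loopSet x = K.loopSet x := by
      ext e
      exact ⟨fun h ↦ (hlink.1 h).1, fun h ↦ hlink.2 ⟨h, hx, hx⟩⟩
    rw [degree, i1, i2]
    exact (hd2 x (hDW x hx)).symm

/-- A finite edge set is independent in `M_k(G)` if it contains no member of `circuits G k`. -/
def IndepSet {α β : Type*} (G : Graph α β) (k : ℕ) (I : Finset β) : Prop :=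
  (I : Set β) ⊆ E(G) ∧ ∀ C ∈ circuits G k, ¬ C ⊆ (I : Set β)

theorem indepSet_iff {α β : Type*} {G : Graph α β} {k : ℕ} (hk : 1 ≤ k) {I : Finset β} :
    IndepSet G k I ↔ (I : Set β) ⊆ E(G) ∧
      ∀ X ⊆ I, X.Nonempty → X.card < (ends G X).card + k := by
  refine and_congr_right fun hI ↦ ⟨fun h X hXI hX ↦ ?_, fun h C hC hCI ↦ ?_⟩
  · by_contra! hcon
    have hsub : (X : Set β) ⊆ I := by exact_mod_cast hXI
    obtain ⟨C, hC, hCX⟩ := exists_circuit hk X (hsub.trans hI) hX hcon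
    exact h C hC (hCX.trans hsub)
  · obtain ⟨hCE, hCf, hex, -⟩ := hC
    lift C to Finset β using hCf
    rw [excess_edgeInduced hCE] at hex
    have hne : C.Nonempty := by rw [← Finset.card_pos]; omega
    have := h C (by exact_mod_cast hCI) hne
    omega

theorem indepSet_empty {α β : Type*} (G : Graph α β) {k : ℕ} (hk : 1 ≤ k) : IndepSet G k ∅ := by
  rw [indepSet_iff hk]
  refine ⟨by simp, fun X hX hne ↦ ?_⟩
  rw [Finset.subset_empty.1 hX] at hne
  exact absurd hne Finset.not_nonempty_empty

theorem IndepSet.subset {α β : Type*} {G : Graph α β} {k : ℕ} {I J : Finset β}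
    (hJ : IndepSet G k J) (hIJ : I ⊆ J) : IndepSet G k I :=
  ⟨(Finset.coe_subset.2 hIJ).trans hJ.1,
    fun C hC hCI ↦ hJ.2 C hC (hCI.trans (Finset.coe_subset.2 hIJ))⟩

open Classical in
theorem indepSet_aug {α β : Type*} {G : Graph α β} {k : ℕ} (hk : 1 ≤ k) ⦃I J : Finset β⦄
    (hI : IndepSet G k I) (hJ : IndepSet G k J) (hIJ : I.card < J.card) :
    ∃ e ∈ J, e ∉ I ∧ IndepSet G k (insert e I) := by
  rw [indepSet_iff hk] at hI hJ
  by_contra! hcon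
  obtain ⟨hIE, hI⟩ := hI
  obtain ⟨hJE, hJ⟩ := hJ
  -- the tight subsets of `I`, and the maximal ones
  set 𝒯 := {T ∈ I.powerset | T.Nonempty ∧ (ends G T).card + k = T.card + 1} with h𝒯
  have tight : ∀ {T}, T ∈ 𝒯 ↔ T ⊆ I ∧ T.Nonempty ∧ (ends G T).card + k = T.card + 1 := by
    simp [h𝒯]
  have hunion : ∀ S ∈ 𝒯, ∀ T ∈ 𝒯, (S ∩ T).Nonempty → S ∪ T ∈ 𝒯 := by
    intro S hS T hT hST
    rw [tight] at hS hT ⊢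
    have hsub : S ∪ T ⊆ I := Finset.union_subset hS.1 hT.1
    have hne : (S ∪ T).Nonempty := hS.2.1.mono Finset.subset_union_left
    have a1 := hI _ hsub hne
    have a2 := hI _ (Finset.inter_subset_left.trans hS.1) hST
    have a3 := Finset.card_union_add_card_inter S T
    have a4 := Finset.card_union_add_card_inter (ends G S) (ends G T)
    have a5 : ends G (S ∪ T) = ends G S ∪ ends G T := by
      ext x; simp only [Finset.mem_union, mem_ends]
      constructor
      · rintro ⟨e, he | he, hx⟩
        exacts [Or.inl ⟨e, he, hx⟩, Or.inr ⟨e, he, hx⟩]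
      · rintro (⟨e, he, hx⟩ | ⟨e, he, hx⟩)
        exacts [⟨e, Or.inl he, hx⟩, ⟨e, Or.inr he, hx⟩]
    have a6 : (ends G (S ∩ T)).card ≤ (ends G S ∩ ends G T).card :=
      Finset.card_le_card (Finset.subset_inter (ends_mono G Finset.inter_subset_left)
        (ends_mono G Finset.inter_subset_right))
    rw [← a5] at a4
    exact ⟨hsub, hne, by omega⟩
  have htight : ∀ e ∈ J, e ∉ I → ∃ T ∈ 𝒯, ∀ x, G.Inc e x → x ∈ ends G T := by
    intro e heJ heI
    have hne := hcon e heJ heI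
    have hins : ((insert e I : Finset β) : Set β) ⊆ E(G) := by
      rw [Finset.coe_insert]
      exact Set.insert_subset (hJE heJ) hIE
    rw [indepSet_iff hk] at hne
    push Not at hne
    obtain ⟨X, hX, hXne, hXc⟩ := hne hins
    have heX : e ∈ X := by
      by_contra heX
      have := hI X (fun f hf ↦ (Finset.mem_insert.1 (hX hf)).resolve_left
        (fun h ↦ heX (h ▸ hf))) hXne
      omega
    have hT : X.erase e ⊆ I := fun f hf ↦ by
      rw [Finset.mem_erase] at hf
      exact (Finset.mem_insert.1 (hX hf.2)).resolve_left hf.1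
    have hXpos := ends_pos hXne (fun f hf ↦ hins (hX hf))
    have hc := Finset.card_erase_of_mem heX
    have hTne : (X.erase e).Nonempty := by rw [← Finset.card_pos]; omega
    have b1 := hI _ hT hTne
    have b2 := Finset.card_le_card (ends_mono G (Finset.erase_subset e X))
    refine ⟨X.erase e, tight.2 ⟨hT, hTne, by omega⟩, fun x hx ↦ ?_⟩
    rw [Finset.eq_of_subset_of_card_le (ends_mono G (Finset.erase_subset e X)) (by omega)]
    exact mem_ends.2 ⟨e, heX, hx⟩
  set ℳ := {T ∈ 𝒯 | ∀ S ∈ 𝒯, T ⊆ S → S = T} with hℳ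
  have hmax : ∀ T ∈ 𝒯, ∃ S ∈ ℳ, T ⊆ S := by
    intro T hT
    obtain ⟨S, hTS, hS⟩ := 𝒯.exists_le_maximal hT
    refine ⟨S, Finset.mem_filter.2 ⟨hS.prop, fun R hR hSR ↦ ?_⟩, hTS⟩
    exact (hS.eq_of_le hR hSR).symm
  have hdisj : (ℳ : Set (Finset β)).PairwiseDisjoint id := by
    intro S hS T hT hne
    simp only [hℳ, Finset.coe_filter, Set.mem_ofPred_eq] at hS hT
    by_contra hnd
    have hU := hunion S hS.1 T hT.1 (Finset.not_disjoint_iff_nonempty_inter.1 hnd)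
    exact hne ((hS.2 _ hU Finset.subset_union_left).symm.trans
      (hT.2 _ hU Finset.subset_union_right))
  set U := ℳ.biUnion id with hU
  have hUI : U ⊆ I := by
    intro f hf
    obtain ⟨T, hT, hfT⟩ := Finset.mem_biUnion.1 hf
    exact (tight.1 (Finset.mem_filter.1 hT).1).1 hfT
  let P : Finset β → Finset β := fun T ↦ {f ∈ J | ∀ x, G.Inc f x → x ∈ ends G T}
  have hP : ∀ T ∈ ℳ, (P T).card ≤ T.card := by
    intro T hT
    obtain ⟨-, -, hTc⟩ := tight.1 (Finset.mem_filter.1 hT).1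
    rcases (P T).eq_empty_or_nonempty with h | h
    · simp [h]
    have d1 := hJ (P T) (Finset.filter_subset _ _) h
    have d2 : (ends G (P T)).card ≤ (ends G T).card := Finset.card_le_card fun x hx ↦ by
      obtain ⟨f, hf, hfx⟩ := mem_ends.1 hx
      exact (Finset.mem_filter.1 hf).2 x hfx
    omega
  have hcover : J ⊆ ℳ.biUnion P ∪ (I \ U) := by
    intro f hf
    rw [Finset.mem_union, Finset.mem_biUnion, Finset.mem_sdiff]
    by_cases hfU : f ∈ U
    · obtain ⟨T, hT, hfT⟩ := Finset.mem_biUnion.1 hfU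
      exact Or.inl ⟨T, hT, Finset.mem_filter.2 ⟨hf, fun x hx ↦ mem_ends.2 ⟨f, hfT, hx⟩⟩⟩
    by_cases hfI : f ∈ I
    · exact Or.inr ⟨hfI, hfU⟩
    · obtain ⟨T, hT, hfT⟩ := htight f hf hfI
      obtain ⟨S, hS, hTS⟩ := hmax T hT
      exact Or.inl ⟨S, hS, Finset.mem_filter.2 ⟨hf, fun x hx ↦ ends_mono G hTS (hfT x hx)⟩⟩
  have f1 := Finset.card_le_card hcover
  have f2 := Finset.card_union_le (ℳ.biUnion P) (I \ U)
  have f3 : (ℳ.biUnion P).card ≤ ∑ T ∈ ℳ, T.card :=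
    Finset.card_biUnion_le.trans (Finset.sum_le_sum hP)
  have f4 : U.card = ∑ T ∈ ℳ, T.card := Finset.card_biUnion hdisj
  have f5 := Finset.card_sdiff_of_subset hUI
  have f6 := Finset.card_le_card hUI
  omega

open Classical in
/-- The `k`-circular matroid `M_k(G)` of `G` (`k ≥ 1`): the matroid on `E(G)` whose circuits are the
members of `circuits G k` (see `kCircularMatroid_isCircuit_iff`). For `k = 1` it is the bicircular
matroid of `G`. -/
noncomputable def kCircularMatroid {α β : Type*} (G : Graph α β) (k : ℕ) (hk : 1 ≤ k) : Matroid β :=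
  (IndepMatroid.ofFinset E(G) (IndepSet G k)
    (indepSet_empty G hk) (fun _ _ hJ hIJ ↦ hJ.subset hIJ) (indepSet_aug hk) (fun _ hI ↦ hI.1)).matroid

theorem kCircularMatroid_ground {α β : Type*} (G : Graph α β) (k : ℕ) (hk : 1 ≤ k) :
    (kCircularMatroid G k hk).E = E(G) := rfl

theorem kCircularMatroid_indep_iff {α β : Type*} (G : Graph α β) (k : ℕ) (hk : 1 ≤ k)
    (I : Set β) :
    (kCircularMatroid G k hk).Indep I ↔ I ⊆ E(G) ∧ ∀ C ∈ circuits G k, ¬ C ⊆ I := by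
  classical
  have h0 : (kCircularMatroid G k hk).Indep I ↔
      ∀ J : Finset β, (J : Set β) ⊆ I → IndepSet G k J := by
      rw [kCircularMatroid, IndepMatroid.matroid_Indep, IndepMatroid.ofFinset_indep']
  rw [h0]
  refine ⟨fun h ↦ ⟨fun e he ↦ ?_, fun C hC hCI ↦ ?_⟩, fun h J hJ ↦
    ⟨hJ.trans h.1, fun C hC hCJ ↦ h.2 C hC (hCJ.trans hJ)⟩⟩
  · exact (h {e} (by simpa using he)).1 (by simp)
  · obtain ⟨D, rfl⟩ := hC.2.1.exists_finset_coe
    exact (h D hCI).2 _ hC subset_rfl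

theorem kCircularMatroid_isCircuit_iff {α β : Type*} (G : Graph α β) (k : ℕ) (hk : 1 ≤ k)
    (C : Set β) : (kCircularMatroid G k hk).IsCircuit C ↔ C ∈ circuits G k := by
  rw [Matroid.isCircuit_iff_forall_ssubset, Matroid.dep_iff, kCircularMatroid_indep_iff,
    kCircularMatroid_ground]
  constructor
  · rintro ⟨⟨hdep, hCE⟩, hmin⟩
    push Not at hdep
    obtain ⟨D, hD, hDC⟩ := hdep hCE
    rcases hDC.eq_or_ssubset with rfl | hss
    · exact hD
    · exact absurd subset_rfl (((kCircularMatroid_indep_iff G k hk D).1 (hmin hss)).2 D hD)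
  · intro hC
    refine ⟨⟨fun h ↦ h.2 C hC subset_rfl, hC.1⟩, fun I hI ↦ ?_⟩
    rw [kCircularMatroid_indep_iff]
    refine ⟨hI.subset.trans hC.1, fun D hD hDI ↦ ?_⟩
    have hDC : D ⊂ C := hDI.trans_ssubset hI
    obtain ⟨hCE, hCf, hCk, hCc⟩ := hC
    obtain ⟨hDE, hDf, hDk, -⟩ := hD
    lift C to Finset β using hCf
    lift D to Finset β using hDf
    have := hCc.excess_lt (by exact_mod_cast hDC)
    rw [excess_edgeInduced hCE] at hCk
    rw [excess_edgeInduced hDE] at hDk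
    omega

end KCircular

namespace KCircular

/-! A set I of edges is independent in the bicircular matroid exactly when |X| ≤ |V(G⟨X⟩)| for every
X ⊆ I. Hence the rank of X is at most |V(G⟨X⟩)|, and equality holds when X is a union of circuits
(`IsCyclicSet.card_eq`). For such X the matroid therefore determines the number of vertices spanned,
whichever graph represents it (`IsCyclicSet.card_ends_eq`).

A cactus with Δ ≥ 1 is a union of circuits (`IsCactus.isCyclicSet`). Applied to G, this gives
|V(G')| = |V(G)|. Applied to G \ x, it shows that the edges of G avoiding x span all but one vertex
x' of G', and x' has the same star as x (`exists_star_eq`). Distinct vertices of G have distinct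
stars, because no vertex of G \ x is isolated. So x ↦ x' is a bijection, and stars determine the
ends of every edge. -/

open Classical in
theorem ends_union {α β : Type*} (G : Graph α β) (X Y : Finset β) :
    ends G (X ∪ Y) = ends G X ∪ ends G Y := by
  ext x
  simp only [Finset.mem_union, mem_ends, or_and_right, exists_or]

/-! ### Independent sets and tight sets -/

theorem IndepSet.card_le {α β : Type*} {G : Graph α β} {I : Finset β} (hI : IndepSet G 1 I) :
    I.card ≤ (ends G I).card := by
  rcases I.eq_empty_or_nonempty with rfl | hne
  · simp
  · have := ((indepSet_iff le_rfl).1 hI).2 I subset_rfl hne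
    omega

theorem card_of_mem_circuits {α β : Type*} {G : Graph α β} {k : ℕ} {C : Finset β}
    (hC : (C : Set β) ∈ circuits G k) : C.card = (ends G C).card + k := by
  have := hC.2.2.1
  rw [excess_edgeInduced hC.1] at this
  omega

open Classical in
/-- The union of two sets `S` with `Δ(G⟨S⟩) = 0` inside an independent set is again of this kind. -/
theorem IndepSet.card_union_eq {α β : Type*} {G : Graph α β} {I S T : Finset β}
    (hI : IndepSet G 1 I) (hS : S ⊆ I) (hT : T ⊆ I) (hSc : (ends G S).card ≤ S.card)
    (hTc : (ends G T).card ≤ T.card) : (ends G (S ∪ T)).card = (S ∪ T).card := by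
  -- Uncrossing: X ↦ |V(G⟨X⟩)| is submodular and X ↦ |X| is modular, while independence bounds the
  -- union and the intersection from the other side, which forces equality.
  have a1 := (hI.subset (Finset.union_subset hS hT)).card_le
  have a2 := (hI.subset (Finset.inter_subset_left.trans hS : S ∩ T ⊆ I)).card_le
  have a3 := Finset.card_union_add_card_inter S T
  have a4 := Finset.card_union_add_card_inter (ends G S) (ends G T)
  have a6 : (ends G (S ∩ T)).card ≤ (ends G S ∩ ends G T).card :=
    Finset.card_le_card (Finset.subset_inter (ends_mono G Finset.inter_subset_left)
      (ends_mono G Finset.inter_subset_right))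
  rw [ends_union] at a1 ⊢
  omega

/-! ### The rank of a union of circuits -/

/-- `X` is a union of circuits of the bicircular matroid of `G`. -/
def IsCyclicSet {α β : Type*} (G : Graph α β) (X : Finset β) : Prop :=
  ∀ e ∈ X, ∃ C : Finset β, (C : Set β) ∈ circuits G 1 ∧ C ⊆ X ∧ e ∈ C

theorem exists_maximal_indepSet {α β : Type*} (G : Graph α β) (X : Finset β) :
    ∃ I ⊆ X, IndepSet G 1 I ∧ ∀ J ⊆ X, IndepSet G 1 J → I ⊆ J → J = I := by
  classical
  have hne : (X.powerset.filter (IndepSet G 1)).Nonempty :=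
    ⟨∅, by simp [indepSet_empty G le_rfl]⟩
  obtain ⟨I, hI, hmax⟩ := Finset.exists_max_image _ Finset.card hne
  simp only [Finset.mem_filter, Finset.mem_powerset] at hI hmax
  exact ⟨I, hI.1, hI.2, fun J hJ hJi hIJ ↦
    (Finset.eq_of_subset_of_card_le hIJ (hmax J ⟨hJ, hJi⟩)).symm⟩

open Classical in
/-- A maximal independent subset of a union of circuits has as many elements as there are
vertices. -/
theorem IsCyclicSet.card_eq {α β : Type*} {G : Graph α β} {X I : Finset β}
    (hX : IsCyclicSet G X) (hIX : I ⊆ X) (hI : IndepSet G 1 I)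
    (hmax : ∀ J ⊆ X, IndepSet G 1 J → I ⊆ J → J = I) : I.card = (ends G X).card := by
  have hXE : ∀ e ∈ X, e ∈ E(G) := fun e he ↦ by
    obtain ⟨C, hC, -, heC⟩ := hX e he
    exact hC.1 heC
  -- T is a largest tight subset of I. By uncrossing it contains all the others. The empty set is
  -- tight, so T may be empty.
  obtain ⟨T, hT, hTmax⟩ := Finset.exists_max_image
    (I.powerset.filter fun S ↦ (ends G S).card ≤ S.card) Finset.card
    ⟨∅, by simp [ends, edgeInduced]⟩
  simp only [Finset.mem_filter, Finset.mem_powerset] at hT hTmax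
  obtain ⟨hTI, hTc⟩ := hT
  have habs : ∀ S ⊆ I, (ends G S).card ≤ S.card → S ⊆ T := by
    intro S hS hSc
    have h := hTmax (S ∪ T) ⟨Finset.union_subset hS hTI, (hI.card_union_eq hS hTI hSc hTc).le⟩
    rw [Finset.eq_of_subset_of_card_le Finset.subset_union_right h]
    exact Finset.subset_union_left
  -- Adding e creates a dependent Y. Then Y - e is tight with the same ends as Y, so it lies in T,
  -- and T already covers the ends of e.
  have hout : ∀ e ∈ X, e ∉ I → ∀ x, G.Inc e x → x ∈ ends G T := by
    intro e heX heI x hx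
    have hni : ¬ IndepSet G 1 (insert e I) := fun h ↦ heI <| by
      rw [← hmax _ (Finset.insert_subset heX hIX) h (Finset.subset_insert e I)]
      exact Finset.mem_insert_self e I
    have hsub : ((insert e I : Finset β) : Set β) ⊆ E(G) := fun f hf ↦
      hXE f (Finset.insert_subset heX hIX hf)
    rw [indepSet_iff le_rfl] at hni
    push Not at hni
    obtain ⟨Y, hY, hYne, hYc⟩ := hni hsub
    have hYI : Y.erase e ⊆ I := fun f hf ↦
      (Finset.mem_insert.1 (hY (Finset.mem_of_mem_erase hf))).resolve_left
        (Finset.ne_of_mem_erase hf)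
    have heY : e ∈ Y := by
      by_contra heY
      rw [Finset.erase_eq_of_notMem heY] at hYI
      have := (hI.subset hYI).card_le
      omega
    have hc := Finset.card_erase_of_mem heY
    have b1 := (hI.subset hYI).card_le
    have b2 := ends_mono G (Finset.erase_subset e Y)
    have b3 := Finset.card_le_card b2
    have b4 := habs _ hYI (by omega)
    have b5 := Finset.eq_of_subset_of_card_le b2 (by omega)
    exact ends_mono G b4 (b5 ▸ mem_ends.2 ⟨e, heY, hx⟩)
  have hall : ∀ e ∈ X, ∀ x, G.Inc e x → x ∈ ends G T := by
    intro e heX x hx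
    by_contra hxT
    obtain ⟨C, hC, hCX, heC⟩ := hX e heX
    -- Y is the part of the circuit C already covered by T. As it is proper, strict monotonicity of
    -- Δ on cacti-graphs gives |Y| ≤ |V(G⟨Y⟩)|. The rest of C lies in I and avoids T.
    set Y := {f ∈ C | ∀ y, G.Inc f y → y ∈ ends G T}
    have hYC : Y ⊂ C := (Finset.filter_subset _ _).ssubset_of_ne fun h ↦
      hxT (Finset.filter_eq_self.1 h e heC x hx)
    have hYlt := IsCactiGraph.excess_lt hC.2.2.2 hYC
    have hCc := card_of_mem_circuits hC
    have hZI : C \ Y ⊆ I := fun f hf ↦ by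
      rw [Finset.mem_sdiff] at hf
      by_contra hfI
      exact hf.2 (Finset.mem_filter.2 ⟨hf.1, hout f (hCX hf.1) hfI⟩)
    have hdisj : Disjoint (C \ Y) T := Finset.disjoint_left.2 fun f hf hfT ↦ by
      rw [Finset.mem_sdiff] at hf
      exact hf.2 (Finset.mem_filter.2 ⟨hf.1, fun y hy ↦ mem_ends.2 ⟨f, hfT, hy⟩⟩)
    -- The independent set (C \ Y) ∪ T is now too large: it spans at most |V(G⟨C⟩)| + |V(G⟨T⟩)| -
    -- |Y| vertices but has at least one more edge, since Δ(G⟨C⟩) = 1 and T is tight.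
    have c1 := (hI.subset (Finset.union_subset hZI hTI)).card_le
    rw [Finset.card_union_of_disjoint hdisj, Finset.card_sdiff_of_subset hYC.subset,
      ends_union] at c1
    have c2 : (ends G (C \ Y) ∪ ends G T).card ≤ (ends G C ∪ ends G T).card :=
      Finset.card_le_card (Finset.union_subset_union_left (ends_mono G Finset.sdiff_subset))
    have c3 := Finset.card_union_add_card_inter (ends G C) (ends G T)
    have c4 : (ends G Y).card ≤ (ends G C ∩ ends G T).card :=
      Finset.card_le_card (Finset.subset_inter (ends_mono G hYC.subset) fun y hy ↦ by
        obtain ⟨f, hf, hfy⟩ := mem_ends.1 hy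
        exact (Finset.mem_filter.1 hf).2 y hfy)
    have c5 := Finset.card_lt_card hYC
    omega
  have hXT : ends G X ⊆ ends G T := fun x hx ↦ by
    obtain ⟨e, he, hex⟩ := mem_ends.1 hx
    exact hall e he x hex
  -- |V(G⟨X⟩)| ≤ |V(G⟨T⟩)| ≤ |T| ≤ |I| ≤ |V(G⟨I⟩)| ≤ |V(G⟨X⟩)|.
  have d1 := Finset.card_le_card hXT
  have d2 := Finset.card_le_card hTI
  have d3 := hI.card_le
  have d4 := Finset.card_le_card (ends_mono G hIX)
  omega

/-! ### Cacti are unions of circuits -/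

theorem ends_edgeSet {α β : Type*} {G : Graph α β} (hV : V(G).Finite) (hE : E(G).Finite)
    (hiso : NoIsolatedVertices G) : ends G hE.toFinset = hV.toFinset := by
  ext x
  simp only [mem_ends, Set.Finite.mem_toFinset]
  refine ⟨fun ⟨e, _, h⟩ ↦ h.vertex_mem, fun hx ↦ ?_⟩
  obtain ⟨e, he⟩ := hiso x hx
  exact ⟨e, he.edge_mem, he⟩

open Classical in
/-- In a cactus `G` with `Δ(G) ≥ 1` every edge lies in a circuit of the bicircular matroid. -/
theorem IsCactus.isCyclicSet {α β : Type*} {G : Graph α β} (hG : IsCactus G)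
    (hV : V(G).Finite) (hE : E(G).Finite) (hex : 1 ≤ excess G) : IsCyclicSet G hE.toFinset := by
  obtain ⟨⟨-, hconn⟩, hiso, hleaf, -⟩ := hG
  set E := hE.toFinset with hEdef
  have hEmem : ∀ e, e ∈ E ↔ e ∈ E(G) := fun e ↦ by simp [hEdef]
  have hEends : ends G E = hV.toFinset := ends_edgeSet hV hE hiso
  rw [excess, Set.ncard_eq_toFinset_card _ hE, Set.ncard_eq_toFinset_card _ hV, ← hEends,
    ← hEdef] at hex
  have hEsub : (E : Set β) ⊆ E(G) := fun e he ↦ (hEmem e).1 he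
  set U := {e ∈ E | ∃ C : Finset β, (C : Set β) ∈ circuits G 1 ∧ e ∈ C} with hU
  have hCU : ∀ C : Finset β, (C : Set β) ∈ circuits G 1 → C ⊆ U := fun C hC e he ↦
    Finset.mem_filter.2 ⟨(hEmem e).2 (hC.1 he), C, hC, he⟩
  have hUcyc : IsCyclicSet G U := fun e he ↦ by
    obtain ⟨-, C, hC, heC⟩ := Finset.mem_filter.1 he
    exact ⟨C, hC, hCU C hC, heC⟩
  have hUE : U ⊆ E := Finset.filter_subset _ _
  suffices hUeq : E ⊆ U by rwa [Finset.Subset.antisymm hUE hUeq] at hUcyc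
  obtain ⟨I, hIU, hI, hmax⟩ := exists_maximal_indepSet G U
  have hIc := hUcyc.card_eq hIU hI hmax
  -- Edges outside U lie in no circuit, so they can be added to I freely. As |I| = |V(G⟨U⟩)|, this
  -- yields |E \ U| ≤ |W| for the set W of vertices missed by U.
  have hJ : IndepSet G 1 (E \ U ∪ I) := by
    refine ⟨fun e he ↦ ?_, fun C hC hCJ ↦ hI.2 C hC fun e he ↦ ?_⟩
    · rcases Finset.mem_union.1 he with he | he
      · exact hEsub (Finset.mem_sdiff.1 he).1
      · exact hEsub (hUE (hIU he))
    · obtain ⟨D, rfl⟩ := hC.2.1.exists_finset_coe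
      rcases Finset.mem_union.1 (hCJ he) with h | h
      · exact absurd (hCU D hC he) (Finset.mem_sdiff.1 h).2
      · exact h
  have hJc := hJ.card_le
  rw [Finset.card_union_of_disjoint (Finset.disjoint_of_subset_right hIU Finset.sdiff_disjoint)]
    at hJc
  have hJe : (ends G (E \ U ∪ I)).card ≤ (ends G E).card :=
    Finset.card_le_card (ends_mono G
      (Finset.union_subset Finset.sdiff_subset (hIU.trans hUE)))
  set W := ends G E \ ends G U with hW
  have hWc : W.card = (ends G E).card - (ends G U).card :=
    Finset.card_sdiff_of_subset (ends_mono G hUE)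
  have hUc := Finset.card_le_card (ends_mono G hUE)
  have hinc : ∀ w ∈ W, ∀ e, G.Inc e w → e ∈ E \ U := fun w hw e he ↦
    Finset.mem_sdiff.2 ⟨(hEmem e).2 he.edge_mem, fun heU ↦
      (Finset.mem_sdiff.1 hw).2 (mem_ends.2 ⟨e, heU, he⟩)⟩
  have hdeg : ∀ w ∈ W, 2 ≤ degree G w := by
    intro w hw
    have hwV : w ∈ V(G) := by
      have := (Finset.mem_sdiff.1 hw).1
      rwa [hEends, Set.Finite.mem_toFinset] at this
    have h1 := hleaf w hwV
    have h2 : 0 < (G.incidenceSet w).ncard :=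
      (Set.ncard_pos (hE.subset (G.incidenceSet_subset_edgeSet w))).2 (hiso w hwV)
    simp only [degree] at h1 ⊢
    omega
  have hsum := sum_degree G W (E \ U) hinc
  have s1 : ∑ _w ∈ W, 2 ≤ ∑ w ∈ W, degree G w := Finset.sum_le_sum hdeg
  have s2 : ∑ e ∈ E \ U, endCount G W e ≤ ∑ _e ∈ E \ U, 2 :=
    Finset.sum_le_sum fun e _ ↦ (endCount_le G W e).1
  have s3 : ∑ _w ∈ W, 2 = W.card * 2 := by simp
  have s4 : ∑ _e ∈ E \ U, 2 = (E \ U).card * 2 := by simp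
  -- 2|W| ≤ ∑ deg ≤ 2|E \ U| ≤ 2|W| is an equality throughout, so every edge outside U has both ends
  -- in W.
  have he2 : ∀ e ∈ E \ U, endCount G W e = 2 :=
    (Finset.sum_eq_sum_iff_of_le fun e _ ↦ (endCount_le G W e).1).1 (by omega)
  have hadj : ∀ x ∈ W, ∀ y, G.Adj x y → y ∈ W := by
    rintro x hx y ⟨e, he⟩
    exact (endCount_le G W e).2.1 (he2 e (hinc x hx e he.inc_left)) y he.inc_right
  have hUne : (ends G U).Nonempty := by
    obtain ⟨C, hC, -⟩ := exists_circuit le_rfl E hEsub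
      (Finset.card_pos.1 (by omega)) (by omega)
    obtain ⟨D, rfl⟩ := hC.2.1.exists_finset_coe
    have hDne : D.Nonempty := Finset.card_pos.1 (by have := card_of_mem_circuits hC; omega)
    exact (Finset.card_pos.1 (ends_pos hDne hC.1)).mono (ends_mono G (hCU D hC))
  -- W is closed under adjacency and misses the nonempty set of ends of U, so connectedness empties
  -- it.
  have hWe : W = ∅ := by
    by_contra hne
    obtain ⟨w, hw⟩ := Finset.nonempty_iff_ne_empty.2 hne
    obtain ⟨u, hu⟩ := hUne
    have hmemV : ∀ x ∈ ends G E, x ∈ V(G) := fun x hx ↦ by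
      rwa [hEends, Set.Finite.mem_toFinset] at hx
    have hwalk := hconn w (hmemV w (Finset.mem_sdiff.1 hw).1) u (hmemV u (ends_mono G hUE hu))
    have hclosed : ∀ y, Relation.ReflTransGen G.Adj w y → y ∈ W := fun y hy ↦ by
      induction hy with
      | refl => exact hw
      | tail _ h ih => exact hadj _ ih _ h
    have huW := hclosed u hwalk
    exact (Finset.mem_sdiff.1 huW).2 hu
  rw [hWe, Finset.card_empty] at hWc
  have h0 : (E \ U).card = 0 := by omega
  exact Finset.sdiff_eq_empty_iff_subset.1 (Finset.card_eq_zero.1 h0)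

/-- Edge sets which are unions of circuits span equally many vertices in two graphs with the same
edges and circuits. -/
theorem IsCyclicSet.card_ends_eq {α α' β : Type*} {G : Graph α β} {G' : Graph α' β}
    (hE : E(G') = E(G)) (hC : circuits G' 1 = circuits G 1) {X : Finset β}
    (hX : IsCyclicSet G X) : (ends G' X).card = (ends G X).card := by
  have hind : ∀ I, IndepSet G' 1 I ↔ IndepSet G 1 I := fun I ↦ by rw [IndepSet, IndepSet, hE, hC]
  have hX' : IsCyclicSet G' X := by rwa [IsCyclicSet, hC]
  -- Independence depends only on the edges and circuits, so the same I is maximal for both graphs.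
  obtain ⟨I, hIX, hI, hmax⟩ := exists_maximal_indepSet G X
  rw [← hX.card_eq hIX hI hmax,
    hX'.card_eq hIX ((hind I).2 hI) fun J hJX hJ ↦ hmax J hJX ((hind J).1 hJ)]

/-! ### Deleting a vertex -/

theorem edgeInduced_deleteVerts {α β : Type*} {G : Graph α β} {x : α} {C : Set β}
    (hC : C ⊆ E(G.deleteVerts {x})) : edgeInduced (G.deleteVerts {x}) C = edgeInduced G C := by
  have hlink : ∀ e ∈ C, ∀ y z, (G.deleteVerts {x}).IsLink e y z ↔ G.IsLink e y z := by
    refine fun e he y z ↦ ⟨fun h ↦ ((G.deleteVerts_isLink _).1 h).1, fun h ↦ ?_⟩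
    obtain ⟨a, b, hab⟩ := (G.deleteVerts {x}).exists_isLink_of_mem_edgeSet (hC he)
    rw [hab.isLink_iff]
    exact ((G.deleteVerts_isLink _).1 hab).1.isLink_iff.1 h
  refine Graph.ext ?_ fun e y z ↦ and_congr_right fun he ↦ hlink e he y z
  ext y
  exact exists_congr fun e ↦ and_congr_right fun he ↦ exists_congr fun z ↦ hlink e he y z

theorem circuits_deleteVerts_subset {α β : Type*} (G : Graph α β) (x : α) (k : ℕ) :
    circuits (G.deleteVerts {x}) k ⊆ circuits G k := by
  rintro C ⟨h1, h2, h3, h4⟩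
  rw [edgeInduced_deleteVerts h1] at h3 h4
  exact ⟨h1.trans Graph.deleteVerts_le.edgeSet_mono, h2, h3, h4⟩

theorem mem_edgeSet_deleteVerts_iff {α β : Type*} {G : Graph α β} {x : α} {e : β} :
    e ∈ E(G.deleteVerts {x}) ↔ e ∈ E(G) ∧ ¬ G.Inc e x := by
  rw [Graph.edgeSet_deleteVerts]
  constructor
  · rintro ⟨a, b, hab, ha, hb⟩
    refine ⟨hab.edge_mem, fun h ↦ ?_⟩
    rcases h.eq_or_eq_of_isLink hab with rfl | rfl
    exacts [ha rfl, hb rfl]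
  · rintro ⟨he, hx⟩
    obtain ⟨a, b, hab⟩ := G.exists_isLink_of_mem_edgeSet he
    refine ⟨a, b, hab, ?_, ?_⟩
    · rintro rfl
      exact hx hab.inc_left
    · rintro rfl
      exact hx hab.inc_right

/-! ### Recovering vertices from stars -/

/-- The ends of an edge, loops included, are exactly the vertices whose stars contain it. -/
theorem stronglyIsomorphic_of_star_eq {α α' β : Type*} {G : Graph α β} {G' : Graph α' β}
    (hE : E(G) = E(G')) (ν : V(G) ≃ V(G')) (hν : ∀ x : V(G), star G x = star G' (ν x)) :
    StronglyIsomorphic G G' := by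
  have hinc : ∀ (x : V(G)) e, G.Inc e x ↔ G'.Inc e (ν x) := fun x e ↦ by
    rw [← Graph.mem_incidenceSet, ← Graph.mem_incidenceSet]
    exact Set.ext_iff.1 (hν x) e
  refine ⟨hE, ν, fun e x y ↦ ?_⟩
  rw [Graph.isLink_iff_inc, Graph.isLink_iff_inc, hinc, hinc]
  refine and_congr_right fun _ ↦ and_congr_right fun _ ↦ ⟨fun h z hz ↦ ?_, fun h z hz ↦ ?_⟩
  · obtain ⟨w, hw⟩ := ν.surjective ⟨z, hz.vertex_mem⟩
    have hwz : z = ν w := by rw [hw]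
    subst hwz
    simpa [Subtype.coe_inj] using h w ((hinc w e).2 hz)
  · have := h _ ((hinc ⟨z, hz.vertex_mem⟩ e).1 hz)
    simpa [Subtype.coe_inj, Subtype.ext_iff] using this

/-- If `G` and `G'` have the same edges, the same circuits and equally many vertices, and `G \ x` is
a cactus with `Δ(G \ x) ≥ 1`, then the star of `x` in `G` is the star of a vertex of `G'`. -/
theorem exists_star_eq {α α' β : Type*} {G : Graph α β} {G' : Graph α' β}
    (hV : V(G).Finite) (hV' : V(G').Finite) (hEf : E(G).Finite)
    (hcard : hV'.toFinset.card = hV.toFinset.card)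
    (hE : E(G') = E(G)) (hC : circuits G' 1 = circuits G 1) {x : α} (hx : x ∈ V(G))
    (hcac : IsCactus (G.deleteVerts {x})) (hex : 1 ≤ excess (G.deleteVerts {x})) :
    ∃ x' ∈ V(G'), star G x = star G' x' := by
  classical
  have hVx : V(G.deleteVerts {x}).Finite := hV.subset Graph.deleteVerts_le.vertexSet_mono
  have hEx : E(G.deleteVerts {x}).Finite := hEf.subset Graph.deleteVerts_le.edgeSet_mono
  set H := hEx.toFinset with hH
  have hHmem : ∀ e, e ∈ H ↔ e ∈ E(G) ∧ ¬ G.Inc e x := fun e ↦ by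
    rw [hH, Set.Finite.mem_toFinset, mem_edgeSet_deleteVerts_iff]
  have hHcyc : IsCyclicSet G H := fun e he ↦ by
    obtain ⟨C, hC, h⟩ := hcac.isCyclicSet hVx hEx hex e he
    exact ⟨C, circuits_deleteVerts_subset G x 1 hC, h⟩
  have hHends : ends G H = hV.toFinset.erase x := by
    have h1 := ends_edgeSet hVx hEx hcac.2.1
    have h2 : ends G H = ends (G.deleteVerts {x}) H := by
      have h3 := edgeInduced_deleteVerts (G := G) (x := x) (C := (H : Set β)) (by simp [hH])
      ext y
      rw [ends, ends, Set.Finite.mem_toFinset, Set.Finite.mem_toFinset, h3]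
    rw [h2, h1]
    ext y
    simp [and_comm]
  have hxV : x ∈ hV.toFinset := by simpa using hx
  have hc1 : (ends G' H).card + 1 = hV'.toFinset.card := by
    rw [hHcyc.card_ends_eq hE hC, hHends, hcard, Finset.card_erase_add_one hxV]
  have hsubV : ends G' H ⊆ hV'.toFinset := fun y hy ↦ by
    obtain ⟨e, -, he⟩ := mem_ends.1 hy
    simpa using he.vertex_mem
  obtain ⟨x', hx'⟩ := Finset.card_eq_one.1
    (show (hV'.toFinset \ ends G' H).card = 1 by rw [Finset.card_sdiff_of_subset hsubV]; omega)
  have hx'V : x' ∈ hV'.toFinset ∧ x' ∉ ends G' H := by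
    rw [← Finset.mem_sdiff, hx']
    exact Finset.mem_singleton_self x'
  refine ⟨x', by simpa using hx'V.1, ?_⟩
  ext e
  change G.Inc e x ↔ G'.Inc e x'
  constructor
  · intro hex
    by_contra hex'
    have heH : e ∉ H := fun h ↦ ((hHmem e).1 h).2 hex
    -- If e avoids x' in G', then a basis I of H together with e has more edges than vertices in G',
    -- hence contains a circuit D through e.
    obtain ⟨I, hIH, hI, hmax⟩ := exists_maximal_indepSet G H
    have hIc := hHcyc.card_eq hIH hI hmax
    rw [← hHcyc.card_ends_eq hE hC] at hIc
    have hsub : ends G' (insert e I) ⊆ ends G' H := by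
      intro y hy
      obtain ⟨f, hf, hfy⟩ := mem_ends.1 hy
      rcases Finset.mem_insert.1 hf with rfl | hf
      · by_contra hyH
        have : y ∈ hV'.toFinset \ ends G' H :=
          Finset.mem_sdiff.2 ⟨by simpa using hfy.vertex_mem, hyH⟩
        rw [hx', Finset.mem_singleton] at this
        exact hex' (this ▸ hfy)
      · exact mem_ends.2 ⟨f, hIH hf, hfy⟩
    have heI : e ∉ I := fun h ↦ heH (hIH h)
    have hins : ((insert e I : Finset β) : Set β) ⊆ E(G') := fun f hf ↦ by
      rw [hE]
      rcases Finset.mem_insert.1 hf with rfl | hf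
      · exact hex.edge_mem
      · exact hI.1 hf
    obtain ⟨D, hD, hDsub⟩ := exists_circuit le_rfl (insert e I) hins
      (Finset.insert_nonempty e I) (by
        rw [Finset.card_insert_of_notMem heI, hIc]
        exact Nat.add_le_add_right (Finset.card_le_card hsub) 1)
    rw [hC] at hD
    obtain ⟨D, rfl⟩ := hD.2.1.exists_finset_coe
    have hDI : D.erase e ⊆ I := fun f hf ↦
      (Finset.mem_insert.1 (hDsub (Finset.mem_of_mem_erase hf))).resolve_left
        (Finset.ne_of_mem_erase hf)
    have heD : e ∈ D := by
      by_contra heD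
      rw [Finset.erase_eq_of_notMem heD] at hDI
      exact hI.2 _ hD hDI
    have hc := (hI.subset hDI).card_le
    have hDc := card_of_mem_circuits hD
    rw [Finset.card_erase_of_mem heD] at hc
    -- In G the edges of D - e avoid x, so removing e loses the vertex x. Then D - e has |V(G⟨D⟩)|
    -- edges on fewer vertices, contradicting its independence.
    have hlt : (ends G (D.erase e)).card < (ends G D).card := by
      refine Finset.card_lt_card ((ends_mono G (Finset.erase_subset e D)).ssubset_of_ne fun h ↦ ?_)
      have hxD : x ∈ ends G (D.erase e) := h ▸ mem_ends.2 ⟨e, heD, hex⟩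
      obtain ⟨f, hf, hfx⟩ := mem_ends.1 hxD
      exact ((hHmem f).1 (hIH (hDI hf))).2 hfx
    omega
  · intro hex'
    by_contra hex
    exact hx'V.2 (mem_ends.2 ⟨e, (hHmem e).2 ⟨hE ▸ hex'.edge_mem, hex⟩, hex'⟩)

end KCircular

theorem mainTheorem12 {α α' β : Type*} (G : Graph α β) (G' : Graph α' β)
    (hG : KCircular.IsFiniteGraph G) (hG' : KCircular.IsFiniteGraph G')
    (hiso : KCircular.NoIsolatedVertices G')
    (a1 : 1 ≤ KCircular.excess G ∧ KCircular.IsCactus G)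
    (a2 : ∀ x ∈ V(G), 1 ≤ KCircular.excess (G.deleteVerts {x}) ∧
      KCircular.IsCactus (G.deleteVerts {x}))
    (a3 : KCircular.kCircularMatroid G' 1 le_rfl = KCircular.kCircularMatroid G 1 le_rfl) :
    KCircular.vertexStars G = KCircular.vertexStars G' ∧ KCircular.StronglyIsomorphic G G' := by
  open KCircular in
  obtain ⟨hV, hEf⟩ := hG
  obtain ⟨hV', hEf'⟩ := hG'
  have hE : E(G') = E(G) := congrArg Matroid.E a3
  have hC : circuits G' 1 = circuits G 1 := by
    ext C
    rw [← kCircularMatroid_isCircuit_iff G' 1 le_rfl, a3, kCircularMatroid_isCircuit_iff]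
  have hcard : hV'.toFinset.card = hV.toFinset.card := by
    have h := (a1.2.isCyclicSet hV hEf a1.1).card_ends_eq hE hC
    rw [ends_edgeSet hV hEf a1.2.2.1] at h
    rw [← h, ← ends_edgeSet hV' hEf' hiso]
    simp only [hE]
  have hstar : ∀ x : V(G), ∃ x' : V(G'), star G x = star G' x' := fun x ↦ by
    obtain ⟨x', hx', h⟩ := exists_star_eq hV hV' hEf hcard hE hC x.2 (a2 x x.2).2 (a2 x x.2).1
    exact ⟨⟨x', hx'⟩, h⟩
  choose f hf using hstar
  have hinj : Function.Injective f := by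
    intro x y hxy
    by_contra hne
    -- Equal stars would make every edge at y also an edge at x, so y would be isolated in G \ x.
    have hst : star G x = star G y := by rw [hf, hf, hxy]
    have hyV : (y : α) ∈ V(G.deleteVerts {(x : α)}) := by
      rw [Graph.vertexSet_deleteVerts]
      exact ⟨y.2, fun h ↦ hne (Subtype.ext h.symm)⟩
    obtain ⟨e, he⟩ := (a2 x x.2).2.2.1 y hyV
    refine (mem_edgeSet_deleteVerts_iff.1 he.edge_mem).2 ?_
    have hey : e ∈ star G y := Graph.Inc.mono Graph.deleteVerts_le he
    rwa [← hst] at hey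
  have := hV.to_subtype
  have := hV'.to_subtype
  have hbij : Function.Bijective f := by
    refine hinj.bijective_of_nat_card_le ?_
    rw [Nat.card_coe_set_eq, Nat.card_coe_set_eq, Set.ncard_eq_toFinset_card _ hV,
      Set.ncard_eq_toFinset_card _ hV', hcard]
  refine ⟨?_, stronglyIsomorphic_of_star_eq hE.symm (Equiv.ofBijective f hbij) hf⟩
  ext S
  constructor
  · rintro ⟨x, hx, rfl⟩
    exact ⟨f ⟨x, hx⟩, (f ⟨x, hx⟩).2, hf ⟨x, hx⟩⟩
  · rintro ⟨x', hx', rfl⟩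
    obtain ⟨x, hx⟩ := hbij.surjective ⟨x', hx'⟩
    exact ⟨x, x.2, by rw [hf, hx]⟩
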